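/- For $R>0$ and $\kappa\in\mathbb{R}$, let $\mathbb{D}_R=\{(x,y)\in\mathbb{R}^2 : x^2+y^2\le R^2\}$ be equipped with the tensor $g_\kappa$ given in polar coordinates $(x,y)=(r\cos\theta,r\sin\theta)$ by $$g_\kappa=(1+\kappa r^2)^2\,dr^2+r^2\,d\theta^2,$$ that is, $(g_\kappa)_{ij}=\delta_{ij}+(2\kappa+\kappa^2|x|^2)\,x_ix_j$ in Cartesian coordinates $x=(x_1,x_2)$; it is a smooth Riemannian metric on $\mathbb{D}_R$ when $\kappa R^2>-1$. (1) If $|\kappa|R^2<1$, then $(\mathbb{D}_R,g_\kappa)$ is a simple Riemannian surface: its boundary is strictly convex (positive definite second fundamental form with respect to the inward unit normal), it is non-trapping (the exit time of unit-speed geodesics is bounded on the unit tangent bundle), and it has no conjugate points. (2) If $\kappa\ge 1/R^2$, then $(\mathbb{D}_R,g_\kappa)$ has conjugate points. Here a Riemannian surface $(M,g)$ with Gaussian curvature $K$ has conjugate points if there are times $t_0<t_1$, a unit-speed geodesic $\gamma:[t_0,t_1]\to M$, and a nontrivial solution $j$ of $\ddot j(t)+K(\gamma(t))\,j(t)=0$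 on $[t_0,t_1]$ with $j(t_0)=j(t_1)=0$. -/

import Mathlib

open scoped ContDiff

noncomputable section

namespace HerglotzDisk

/-- The plane with its global Cartesian coordinates `x 0`, `x 1`. -/
abbrev Plane : Type := EuclideanSpace ℝ (Fin 2)

/-- The closed disk of radius `R` centred at the origin. -/
def disk (R : ℝ) : Set Plane := Metric.closedBall 0 R

/-- A field of bilinear forms on the plane, given by its Cartesian coefficients `g_ij`. -/
abbrev TensorField : Type := Plane → Matrix (Fin 2) (Fin 2) ℝ

/-- The value `g_x(v, w)`. -/
def pairing (g : TensorField) (x v w : Plane) : ℝ := ∑ i, ∑ j, g x i j * v i * w j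

/-- `g` is a smooth (up to the boundary) Riemannian metric on the closed disk of radius `R`. -/
structure IsRiemannianMetric (g : TensorField) (R : ℝ) : Prop where
  smooth : ∀ x ∈ disk R, ∀ i j, ContDiffAt ℝ ∞ (fun y => g y i j) x
  posDef : ∀ x ∈ disk R, (g x).PosDef

/-- The partial derivative `∂_i f` at `x`. -/
def partialDeriv (i : Fin 2) (f : Plane → ℝ) (x : Plane) : ℝ :=
  fderiv ℝ f x (EuclideanSpace.single i 1)

/-- The Christoffel symbol `Γ^k_ij` of the Levi-Civita connection of `g`. -/
def christoffel (g : TensorField) (k i j : Fin 2) (x : Plane) : ℝ :=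
  (1 / 2) * ∑ l, (g x)⁻¹ k l *
    (partialDeriv i (fun y => g y j l) x + partialDeriv j (fun y => g y i l) x
      - partialDeriv l (fun y => g y i j) x)

/-- The vector with components `∑ Γ^k_ij v^i w^j`. -/
def connectionTerm (g : TensorField) (x v w : Plane) : Plane :=
  WithLp.toLp 2 fun k => ∑ i, ∑ j, christoffel g k i j x * v i * w j

/-- The covariant derivative `∇_v N` at `x` of the vector field `N`. -/
def covDeriv (g : TensorField) (N : Plane → Plane) (x v : Plane) : Plane :=
  fderiv ℝ N x v + connectionTerm g x v (N x)

/-- The component `R^l_kij` of the curvature tensor, where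
`R(∂_i, ∂_j) ∂_k = ∇_i ∇_j ∂_k - ∇_j ∇_i ∂_k = ∑ R^l_kij ∂_l`. -/
def curvatureTensor (g : TensorField) (l k i j : Fin 2) (x : Plane) : ℝ :=
  partialDeriv i (christoffel g l j k) x - partialDeriv j (christoffel g l i k) x
    + ∑ m, (christoffel g l i m x * christoffel g m j k x
        - christoffel g l j m x * christoffel g m i k x)

/-- The Gaussian curvature `g(R(∂_0, ∂_1) ∂_1, ∂_0) / det g`. -/
def gaussCurvature (g : TensorField) (x : Plane) : ℝ :=
  (∑ l, g x l 0 * curvatureTensor g l 1 0 1 x) / (g x).det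

/-- On the time interval `I`, the curve `γ` with velocity `v` is a unit-speed geodesic of `g`
which stays in the closed disk of radius `R` (derivatives at endpoints of `I` are one-sided). -/
structure IsUnitGeodesicOn (g : TensorField) (R : ℝ) (γ v : ℝ → Plane) (I : Set ℝ) : Prop where
  mem : ∀ t ∈ I, γ t ∈ disk R
  unit : ∀ t ∈ I, pairing g (γ t) (v t) (v t) = 1
  hasDeriv : ∀ t ∈ I, HasDerivWithinAt γ (v t) I t
  geodesic : ∀ t ∈ I, HasDerivWithinAt v (-connectionTerm g (γ t) (v t) (v t)) I t

/-- The exit time `τ(x, v)` in `[0, ∞]`: the supremum of the times `T ≥ 0` up to which the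
unit-speed geodesic with initial data `(x, v)` exists and stays in the disk. -/
def exitTime (g : TensorField) (R : ℝ) (x v : Plane) : ENNReal :=
  ⨆ (T : ℝ) (_ : 0 ≤ T ∧ ∃ γ w : ℝ → Plane,
      IsUnitGeodesicOn g R γ w (Set.Icc 0 T) ∧ γ 0 = x ∧ w 0 = v), ENNReal.ofReal T

/-- The disk is non-trapping: the exit time is bounded on the unit tangent bundle. -/
def IsNonTrapping (g : TensorField) (R : ℝ) : Prop :=
  (⨆ (x : Plane) (v : Plane) (_ : x ∈ disk R ∧ pairing g x v v = 1), exitTime g R x v) < ⊤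

/-- The `g`-gradient of the function `-|x|^2 / 2`, which on every circle centred at the origin
is a nonzero inward-pointing normal vector. -/
def inwardGradient (g : TensorField) (x : Plane) : Plane :=
  WithLp.toLp 2 fun k => -∑ l, (g x)⁻¹ k l * x l

/-- The inward-pointing unit normal of the circle centred at the origin through `x`. -/
def inwardNormal (g : TensorField) (x : Plane) : Plane :=
  (Real.sqrt (pairing g x (inwardGradient g x) (inwardGradient g x)))⁻¹ • inwardGradient g x

/-- The second fundamental form `-g(∇_v ν, w)` of the circle centred at the origin through `x`,
with respect to the inward unit normal `ν`. -/
def secondFundamentalForm (g : TensorField) (x v w : Plane) : ℝ :=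
  -pairing g x (covDeriv g (inwardNormal g) x v) w

/-- The boundary circle of radius `R` is strictly convex: its second fundamental form is
positive definite on the tangent lines of the circle. -/
def IsStrictlyConvex (g : TensorField) (R : ℝ) : Prop :=
  ∀ x ∈ Metric.sphere (0 : Plane) R, ∀ v : Plane, inner ℝ x v = 0 → v ≠ 0 →
    0 < secondFundamentalForm g x v v

/-- The points `γ t₀` and `γ t₁` are conjugate along the unit-speed geodesic segment `γ` on
`[t₀, t₁]`: some nontrivial solution of the Jacobi equation `j'' + K(γ) j = 0` vanishes at both
times. -/
def AreConjugateAlong (g : TensorField) (γ : ℝ → Plane) (t₀ t₁ : ℝ) : Prop :=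
  ∃ j j' : ℝ → ℝ,
    (∀ t ∈ Set.Icc t₀ t₁, HasDerivWithinAt j (j' t) (Set.Icc t₀ t₁) t) ∧
    (∀ t ∈ Set.Icc t₀ t₁,
      HasDerivWithinAt j' (-(gaussCurvature g (γ t) * j t)) (Set.Icc t₀ t₁) t) ∧
    j t₀ = 0 ∧ j t₁ = 0 ∧ ∃ t ∈ Set.Icc t₀ t₁, j t ≠ 0

/-- The disk of radius `R` with the metric `g` has conjugate points. -/
def HasConjugatePoints (g : TensorField) (R : ℝ) : Prop :=
  ∃ (γ v : ℝ → Plane) (t₀ t₁ : ℝ), t₀ < t₁ ∧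
    IsUnitGeodesicOn g R γ v (Set.Icc t₀ t₁) ∧ AreConjugateAlong g γ t₀ t₁

/-- The disk of radius `R` with the metric `g` is a simple Riemannian surface: it has a strictly
convex boundary, is non-trapping and has no conjugate points. -/
structure IsSimpleSurface (g : TensorField) (R : ℝ) : Prop where
  isRiemannianMetric : IsRiemannianMetric g R
  isStrictlyConvex : IsStrictlyConvex g R
  isNonTrapping : IsNonTrapping g R
  noConjugatePoints : ¬ HasConjugatePoints g R

/-- The metric `(1 + κ r^2)^2 dr^2 + r^2 dθ^2` in Cartesian coordinates:
`g_ij = δ_ij + (2 κ + κ^2 |x|^2) x_i x_j`. The polar form is proved in `gKappa_polar`. -/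
def gKappa (κ : ℝ) : TensorField := fun x =>
  Matrix.of fun i j =>
    (if i = j then 1 else 0) + (2 * κ + κ ^ 2 * (x 0 ^ 2 + x 1 ^ 2)) * (x i * x j)

/-- Polar coordinates `P(r, θ) = (r cos θ, r sin θ)`. -/
def polarMap (r θ : ℝ) : Plane := !₂[r * Real.cos θ, r * Real.sin θ]

theorem hasDerivAt_polarMap_r (r θ : ℝ) :
    HasDerivAt (fun s => polarMap s θ) !₂[Real.cos θ, Real.sin θ] r := by
  rw [hasDerivAt_iff_hasFDerivAt, ← hasFDerivWithinAt_univ, hasFDerivWithinAt_euclidean]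
  intro i
  rw [hasFDerivWithinAt_univ, hasFDerivAt_iff_hasDerivAt]
  fin_cases i
  · simpa [polarMap] using (hasDerivAt_id r).mul_const (Real.cos θ)
  · simpa [polarMap] using (hasDerivAt_id r).mul_const (Real.sin θ)

theorem hasDerivAt_polarMap_theta (r θ : ℝ) :
    HasDerivAt (fun s => polarMap r s) !₂[-(r * Real.sin θ), r * Real.cos θ] θ := by
  rw [hasDerivAt_iff_hasFDerivAt, ← hasFDerivWithinAt_univ, hasFDerivWithinAt_euclidean]
  intro i
  rw [hasFDerivWithinAt_univ, hasFDerivAt_iff_hasDerivAt]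
  fin_cases i
  · simpa [polarMap] using (Real.hasDerivAt_cos θ).const_mul r
  · simpa [polarMap] using (Real.hasDerivAt_sin θ).const_mul r

/-- `P^* g_κ = (1 + κ r^2)^2 dr^2 + r^2 dθ^2`, evaluated on arbitrary tangent vectors
`a ∂_r + b ∂_θ` and `a' ∂_r + b' ∂_θ`. -/
theorem gKappa_polar (κ r θ a b a' b' : ℝ) :
    pairing (gKappa κ) (polarMap r θ)
      (a • deriv (fun s => polarMap s θ) r + b • deriv (fun s => polarMap r s) θ)
      (a' • deriv (fun s => polarMap s θ) r + b' • deriv (fun s => polarMap r s) θ)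
      = (1 + κ * r ^ 2) ^ 2 * (a * a') + r ^ 2 * (b * b') := by
  rw [(hasDerivAt_polarMap_r r θ).deriv, (hasDerivAt_polarMap_theta r θ).deriv]
  have h : Real.sin θ ^ 2 = 1 - Real.cos θ ^ 2 := by
    linarith [Real.sin_sq_add_cos_sq θ]
  simp [pairing, gKappa, polarMap, Fin.sum_univ_two]
  generalize Real.cos θ = c at *
  generalize Real.sin θ = s at *
  grind

/-- For `κ R^2 > -1`, `g_κ` is a Riemannian metric on the closed disk of radius `R`. -/
theorem gKappa_isRiemannianMetric {R κ : ℝ} (h : -1 < κ * R ^ 2) :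
    IsRiemannianMetric (gKappa κ) R := by
  refine ⟨fun x _ i j => ?_, fun x hx => ?_⟩
  · simp only [gKappa, Matrix.of_apply]
    fun_prop
  · have hr : x 0 ^ 2 + x 1 ^ 2 ≤ R ^ 2 := by
      have h1 : ‖x‖ ≤ R := by simpa [disk] using hx
      have h2 := pow_le_pow_left₀ (norm_nonneg x) h1 2
      rwa [EuclideanSpace.real_norm_sq_eq, Fin.sum_univ_two] at h2
    have ha : 0 < 1 + κ * (x 0 ^ 2 + x 1 ^ 2) := by
      rcases le_or_gt 0 κ with hk | hk
      · positivity
      · nlinarith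
    rw [Matrix.posDef_iff_dotProduct_mulVec]
    refine ⟨?_, fun v hv => ?_⟩
    · ext i j
      fin_cases i <;> fin_cases j <;> simp [gKappa, mul_comm]
    · have hv' : 0 < v 0 ^ 2 + v 1 ^ 2 := by
        by_contra hc
        apply hv
        have h0 : v 0 = 0 := by nlinarith [sq_nonneg (v 0), sq_nonneg (v 1)]
        have h1 : v 1 = 0 := by nlinarith [sq_nonneg (v 0), sq_nonneg (v 1)]
        ext i
        fin_cases i <;> simp [h0, h1]
      have key : star v ⬝ᵥ (gKappa κ x).mulVec v = v 0 ^ 2 + v 1 ^ 2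
          + (2 * κ + κ ^ 2 * (x 0 ^ 2 + x 1 ^ 2)) * (x 0 * v 0 + x 1 * v 1) ^ 2 := by
        simp [dotProduct, Matrix.mulVec, gKappa, Fin.sum_univ_two]
        ring
      rw [key]
      rcases (add_nonneg (sq_nonneg (x 0)) (sq_nonneg (x 1))).eq_or_lt with h0 | h0
      · have h1 : x 0 = 0 := by nlinarith [sq_nonneg (x 0), sq_nonneg (x 1)]
        have h2 : x 1 = 0 := by nlinarith [sq_nonneg (x 0), sq_nonneg (x 1)]
        simpa [h1, h2] using hv'
      · refine pos_of_mul_pos_right (a := x 0 ^ 2 + x 1 ^ 2) ?_ h0.le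
        have e : (x 0 ^ 2 + x 1 ^ 2) * (v 0 ^ 2 + v 1 ^ 2
            + (2 * κ + κ ^ 2 * (x 0 ^ 2 + x 1 ^ 2)) * (x 0 * v 0 + x 1 * v 1) ^ 2)
            = (1 + κ * (x 0 ^ 2 + x 1 ^ 2)) ^ 2 * (x 0 * v 0 + x 1 * v 1) ^ 2
              + (x 0 * v 1 - x 1 * v 0) ^ 2 := by ring
        rw [e]
        rcases eq_or_ne (x 0 * v 0 + x 1 * v 1) 0 with h1 | h1
        · have h3 : (x 0 ^ 2 + x 1 ^ 2) * (v 0 ^ 2 + v 1 ^ 2)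
              = (x 0 * v 0 + x 1 * v 1) ^ 2 + (x 0 * v 1 - x 1 * v 0) ^ 2 := by ring
          have h4 := mul_pos h0 hv'
          rw [h1] at h3 ⊢
          nlinarith
        · positivity

end HerglotzDisk

end

namespace HerglotzDisk

/-! The geodesic equation is explicitly integrable. All Christoffel symbols point radially
(`connectionTerm_gKappa`), so the acceleration is central and the Euclidean angular momentum `L` is
conserved. With `w = (1 + κ|x|²)⟨x, v⟩`, unit speed reads `|x|² = w² + L²`, and `w' = 1/(1 +
κ|x|²)`. Hence `w + κ(w³/3 + L²w) - t` is constant. In the disk `|w| ≤ R`; for `|κ|R² < 1` this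
identity bounds every geodesic's length by `4R` and makes `w` strictly increasing.

The curvature is `2κ/(1 + κ|x|²)³`, and the Jacobi equation has the two explicit solutions `w` and
`y = κw² - (1 + κL²)`, with Wronskian 1. A nontrivial solution vanishing at `a` and `b` forces
`w(a)y(b) - w(b)y(a) = 0`, that is `(w(b) - w(a))(1 + κ(w(a)w(b) + L²)) = 0`. Both factors are
positive when `|κ|R² < 1`, since `|w(a)w(b) + L²| ≤ R²`.

On a diameter `L = 0` and `w` is the signed distance to the centre in the Euclidean sense, so `-y =
1 - κw²` vanishes at `w = ±1/√κ`; both points lie in the disk as soon as `κR² ≥ 1`. -/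

theorem hasDerivWithinAt_plane {f : ℝ → Plane} {f' : Plane} {I : Set ℝ} {t : ℝ} :
    HasDerivWithinAt f f' I t ↔ ∀ i, HasDerivWithinAt (fun s => f s i) (f' i) I t := by
  rw [hasDerivWithinAt_iff_hasFDerivWithinAt, hasFDerivWithinAt_euclidean]
  refine forall_congr' fun i => ?_
  rw [hasDerivWithinAt_iff_hasFDerivWithinAt]
  exact ⟨fun h => h.congr_fderiv (by ext; simp), fun h => h.congr_fderiv (by ext; simp)⟩

/-! ### Calculus of partial derivatives. -/

theorem partialDeriv_eq {f : Plane → ℝ} {x : Plane} {i : Fin 2} {d : ℝ}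
    (hf : DifferentiableAt ℝ f x)
    (h : HasDerivAt (fun t : ℝ => f (x + t • EuclideanSpace.single i 1)) d 0) :
    partialDeriv i f x = d := by
  have h1 : HasDerivAt (fun t : ℝ => x + t • EuclideanSpace.single i (1 : ℝ))
      (EuclideanSpace.single i (1 : ℝ)) 0 := by
    simpa using ((hasDerivAt_id (0 : ℝ)).smul_const (EuclideanSpace.single i (1 : ℝ))).const_add x
  have h2 : HasFDerivAt f (fderiv ℝ f x) (x + (0 : ℝ) • EuclideanSpace.single i (1 : ℝ)) := by
    simpa using hf.hasFDerivAt
  exact (h2.comp_hasDerivAt 0 h1).unique h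

theorem partialDeriv_coord (i j : Fin 2) (x : Plane) :
    partialDeriv i (fun y => y j) x = if i = j then 1 else 0 := by
  refine partialDeriv_eq (by fun_prop) ?_
  have := ((hasDerivAt_id (0 : ℝ)).mul_const
    ((EuclideanSpace.single i (1 : ℝ) : Plane) j)).const_add (x j)
  fin_cases i <;> fin_cases j <;> simpa using this

theorem partialDeriv_mul {i : Fin 2} {f g : Plane → ℝ} {x : Plane}
    (hf : DifferentiableAt ℝ f x) (hg : DifferentiableAt ℝ g x) :
    partialDeriv i (fun y => f y * g y) x
      = partialDeriv i f x * g x + f x * partialDeriv i g x := by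
  simp only [partialDeriv, fderiv_fun_mul hf hg]
  simp
  ring

theorem partialDeriv_add {i : Fin 2} {f g : Plane → ℝ} {x : Plane}
    (hf : DifferentiableAt ℝ f x) (hg : DifferentiableAt ℝ g x) :
    partialDeriv i (fun y => f y + g y) x = partialDeriv i f x + partialDeriv i g x := by
  simp only [partialDeriv, fderiv_fun_add hf hg]
  simp

theorem partialDeriv_const {i : Fin 2} {c : ℝ} {x : Plane} :
    partialDeriv i (fun _ => c) x = 0 := by
  simp [partialDeriv]

theorem partialDeriv_inv {i : Fin 2} {f : Plane → ℝ} {x : Plane}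
    (hf : DifferentiableAt ℝ f x) (h0 : f x ≠ 0) :
    partialDeriv i (fun y => (f y)⁻¹) x = -partialDeriv i f x / f x ^ 2 := by
  have := (hasDerivAt_inv h0).comp_hasFDerivAt x hf.hasFDerivAt
  simp only [partialDeriv]
  rw [show (fun y => (f y)⁻¹) = (fun y => y⁻¹) ∘ f from rfl, this.fderiv]
  simp
  ring

/-- The square of the Euclidean norm, as a polynomial in the coordinates. -/
def normSq (x : Plane) : ℝ := x 0 * x 0 + x 1 * x 1

theorem differentiable_normSq : Differentiable ℝ normSq := by
  unfold normSq
  fun_prop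

theorem differentiableAt_normSq {x : Plane} : DifferentiableAt ℝ normSq x :=
  differentiable_normSq x

theorem partialDeriv_normSq (i : Fin 2) (x : Plane) :
    partialDeriv i normSq x = 2 * x i := by
  have : normSq = fun y : Plane => y 0 * y 0 + y 1 * y 1 := rfl
  rw [this, partialDeriv_add (by fun_prop) (by fun_prop), partialDeriv_mul (by fun_prop)
    (by fun_prop), partialDeriv_mul (by fun_prop) (by fun_prop), partialDeriv_coord,
    partialDeriv_coord]
  fin_cases i <;> simp <;> ring

/-! ### Connection and curvature of `gKappa`. -/

theorem gKappa_apply (κ : ℝ) (i j : Fin 2) (x : Plane) :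
    gKappa κ x i j = (if i = j then 1 else 0)
      + (2 * κ + κ ^ 2 * normSq x) * (x i * x j) := by
  simp [gKappa, normSq, pow_two]

theorem partialDeriv_gKappa (κ : ℝ) (l i j : Fin 2) (x : Plane) :
    partialDeriv l (fun y => gKappa κ y i j) x
      = 2 * κ ^ 2 * (x l * x i * x j) + (2 * κ + κ ^ 2 * normSq x)
        * ((if l = i then 1 else 0) * x j + x i * (if l = j then 1 else 0)) := by
  have hn := @differentiableAt_normSq x
  simp only [gKappa_apply]
  rw [partialDeriv_add (by fun_prop) (by fun_prop), partialDeriv_const,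
    partialDeriv_mul (by fun_prop) (by fun_prop), partialDeriv_mul (by fun_prop) (by fun_prop),
    partialDeriv_add (by fun_prop) (by fun_prop), partialDeriv_const,
    partialDeriv_mul (by fun_prop) (by fun_prop), partialDeriv_const, partialDeriv_normSq,
    partialDeriv_coord, partialDeriv_coord]
  ring

theorem det_gKappa (κ : ℝ) (x : Plane) : (gKappa κ x).det = (1 + κ * normSq x) ^ 2 := by
  rw [Matrix.det_fin_two]
  simp [gKappa_apply]
  simp only [normSq]
  ring

/-- The position vector is an eigenvector of the metric with eigenvalue `(1 + κ|x|²)²`. Where this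
is zero, both sides take the default value 0. -/
theorem sum_inv_gKappa (κ : ℝ) (k : Fin 2) (x : Plane) :
    ∑ l, (gKappa κ x)⁻¹ k l * x l = x k / (1 + κ * normSq x) ^ 2 := by
  rw [Matrix.inv_def, det_gKappa, Ring.inverse_eq_inv', Matrix.adjugate_fin_two,
    Fin.sum_univ_two]
  fin_cases k <;> simp [gKappa_apply] <;> ring

theorem christoffel_gKappa (κ : ℝ) (k i j : Fin 2) (x : Plane) :
    christoffel (gKappa κ) k i j x
      = x k * (κ ^ 2 * (x i * x j) + (2 * κ + κ ^ 2 * normSq x) * (if i = j then 1 else 0))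
        / (1 + κ * normSq x) ^ 2 := by
  -- The combination of first derivatives of the metric is proportional to `x l`, so only the
  -- inverse metric applied to `x` is needed.
  have : christoffel (gKappa κ) k i j x
      = (κ ^ 2 * (x i * x j) + (2 * κ + κ ^ 2 * normSq x) * (if i = j then 1 else 0))
        * ∑ l, (gKappa κ x)⁻¹ k l * x l := by
    simp only [christoffel, Finset.mul_sum]
    refine Finset.sum_congr rfl fun l _ => ?_
    simp only [partialDeriv_gKappa]
    simp only [eq_comm (a := j) (b := i), eq_comm (a := l)]
    ring
  rw [this, sum_inv_gKappa]
  ring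

theorem connectionTerm_gKappa (κ : ℝ) (x v w : Plane) :
    connectionTerm (gKappa κ) x v w
      = ((κ ^ 2 * ((x 0 * v 0 + x 1 * v 1) * (x 0 * w 0 + x 1 * w 1))
          + (2 * κ + κ ^ 2 * normSq x) * (v 0 * w 0 + v 1 * w 1))
        / (1 + κ * normSq x) ^ 2) • x := by
  ext k
  simp [connectionTerm, christoffel_gKappa, Fin.sum_univ_two]
  ring

theorem pairing_gKappa (κ : ℝ) (x v w : Plane) :
    pairing (gKappa κ) x v w = v 0 * w 0 + v 1 * w 1
      + (2 * κ + κ ^ 2 * normSq x) * ((x 0 * v 0 + x 1 * v 1) * (x 0 * w 0 + x 1 * w 1)) := by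
  simp [pairing, gKappa_apply, Fin.sum_univ_two]
  ring

theorem partialDeriv_christoffel_gKappa {κ : ℝ} {x : Plane} (h : 1 + κ * normSq x ≠ 0)
    (m k i j : Fin 2) :
    partialDeriv m (christoffel (gKappa κ) k i j) x
      = ((if m = k then 1 else 0) *
          (κ ^ 2 * (x i * x j) + (2 * κ + κ ^ 2 * normSq x) * (if i = j then 1 else 0))
        + x k * (κ ^ 2 * ((if m = i then 1 else 0) * x j + x i * (if m = j then 1 else 0))
          + 2 * κ ^ 2 * x m * (if i = j then 1 else 0))) / (1 + κ * normSq x) ^ 2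
        - 4 * κ * x m * (x k * (κ ^ 2 * (x i * x j)
          + (2 * κ + κ ^ 2 * normSq x) * (if i = j then 1 else 0)))
          / (1 + κ * normSq x) ^ 3 := by
  have hn := @differentiableAt_normSq x
  have h2 : (1 + κ * normSq x) * (1 + κ * normSq x) ≠ 0 := mul_ne_zero h h
  have e : christoffel (gKappa κ) k i j = fun x => x k * (κ ^ 2 * (x i * x j)
      + (2 * κ + κ ^ 2 * normSq x) * (if i = j then 1 else 0))
        * ((1 + κ * normSq x) * (1 + κ * normSq x))⁻¹ := by
    funext y
    rw [christoffel_gKappa, div_eq_mul_inv, pow_two (1 + κ * normSq y)]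
  have hi : DifferentiableAt ℝ
      (fun x => ((1 + κ * normSq x) * (1 + κ * normSq x))⁻¹) x := by
    fun_prop (disch := exact h2)
  rw [e, partialDeriv_mul (by fun_prop) hi, partialDeriv_inv (by fun_prop) h2,
    partialDeriv_mul (by fun_prop) (by fun_prop), partialDeriv_coord,
    partialDeriv_add (by fun_prop) (by fun_prop), partialDeriv_mul (by fun_prop) (by fun_prop),
    partialDeriv_const, partialDeriv_mul (by fun_prop) (by fun_prop), partialDeriv_coord,
    partialDeriv_coord, partialDeriv_mul (by fun_prop) (by fun_prop), partialDeriv_const,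
    partialDeriv_add (by fun_prop) (by fun_prop), partialDeriv_const,
    partialDeriv_mul (by fun_prop) (by fun_prop), partialDeriv_const, partialDeriv_normSq,
    partialDeriv_mul (by fun_prop) (by fun_prop),
    partialDeriv_add (by fun_prop) (by fun_prop), partialDeriv_const,
    partialDeriv_mul (by fun_prop) (by fun_prop), partialDeriv_const, partialDeriv_normSq]
  generalize (if m = k then (1 : ℝ) else 0) = d1
  generalize (if m = i then (1 : ℝ) else 0) = d2
  generalize (if m = j then (1 : ℝ) else 0) = d3
  generalize (if i = j then (1 : ℝ) else 0) = d4
  field_simp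
  ring

theorem gaussCurvature_gKappa {κ : ℝ} {x : Plane} (h : 1 + κ * normSq x ≠ 0) :
    gaussCurvature (gKappa κ) x = 2 * κ / (1 + κ * normSq x) ^ 3 := by
  simp only [gaussCurvature, curvatureTensor, partialDeriv_christoffel_gKappa h,
    christoffel_gKappa, det_gKappa, Fin.sum_univ_two, gKappa_apply]
  simp
  have e : normSq x = x 0 * x 0 + x 1 * x 1 := rfl
  generalize normSq x = s at *
  field_simp
  subst e
  ring

/-! ### Bounds in the disk and convexity of the boundary. -/

theorem normSq_eq (x : Plane) : normSq x = ‖x‖ ^ 2 := by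
  rw [EuclideanSpace.real_norm_sq_eq, Fin.sum_univ_two, normSq]
  ring

theorem normSq_nonneg (x : Plane) : 0 ≤ normSq x := by
  rw [normSq_eq]
  positivity

theorem mem_disk_iff {R : ℝ} (hR : 0 ≤ R) (x : Plane) : x ∈ disk R ↔ normSq x ≤ R ^ 2 := by
  rw [normSq_eq, sq_le_sq₀ (norm_nonneg x) hR]
  simp [disk]

theorem one_add_mul_bounds {R κ s : ℝ} (h : |κ| * R ^ 2 < 1) (hs : |s| ≤ R ^ 2) :
    0 < 1 + κ * s ∧ 1 + κ * s < 2 := by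
  have h1 : |κ * s| < 1 := by
    rw [abs_mul]
    exact (mul_le_mul_of_nonneg_left hs (abs_nonneg κ)).trans_lt h
  rw [abs_lt] at h1
  constructor <;> linarith

theorem one_add_mul_normSq_pos {R κ : ℝ} (hR : 0 ≤ R) (h : |κ| * R ^ 2 < 1) {x : Plane}
    (hx : x ∈ disk R) : 0 < 1 + κ * normSq x := by
  refine (one_add_mul_bounds h ?_).1
  rw [abs_of_nonneg (normSq_nonneg x)]
  exact (mem_disk_iff hR x).1 hx

theorem inwardNormal_gKappa {κ : ℝ} {x : Plane} (h : 0 < 1 + κ * normSq x) :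
    inwardNormal (gKappa κ) x = (-(‖x‖ * (1 + κ * normSq x))⁻¹) • x := by
  have hg : inwardGradient (gKappa κ) x = (-((1 + κ * normSq x) ^ 2)⁻¹) • x := by
    ext k
    simp only [inwardGradient, sum_inv_gKappa]
    simp
    ring
  have hp : pairing (gKappa κ) x (inwardGradient (gKappa κ) x) (inwardGradient (gKappa κ) x)
      = (‖x‖ / (1 + κ * normSq x)) ^ 2 := by
    rw [hg, pairing_gKappa, div_pow, ← normSq_eq]
    have e : normSq x = x 0 * x 0 + x 1 * x 1 := rfl
    simp only [PiLp.smul_apply, smul_eq_mul]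
    generalize normSq x = s at *
    field_simp
    subst e
    ring
  rw [inwardNormal, hp, Real.sqrt_sq (by positivity), hg, smul_smul]
  congr 1
  by_cases h0 : ‖x‖ = 0
  · simp [h0]
  · field_simp

/-- Up to radial terms, which are orthogonal to tangent vectors, `∇_v ν` is `-v / (R(1 + κR²))`; the
second fundamental form is therefore `|v|² / (R(1 + κR²))`. -/
theorem isStrictlyConvex_gKappa {R κ : ℝ} (hR : 0 < R) (h : |κ| * R ^ 2 < 1) :
    IsStrictlyConvex (gKappa κ) R := by
  intro x hx v hxv hv
  have hxR : ‖x‖ = R := by simpa using hx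
  have hxv' : x 0 * v 0 + x 1 * v 1 = 0 := by
    simpa [PiLp.inner_apply, Fin.sum_univ_two, mul_comm] using hxv
  have hxd : x ∈ disk R := by simp [disk, hxR]
  have ha := one_add_mul_normSq_pos hR.le h hxd
  have hn := @differentiableAt_normSq x
  have hx0 : x ≠ 0 := by
    rintro rfl
    simp at hxR
    exact hR.ne hxR
  have hev : ∀ᶠ y in nhds x, inwardNormal (gKappa κ) y
      = (-(‖y‖ * (1 + κ * normSq y))⁻¹) • y := by
    have hc : ContinuousAt (fun y => 1 + κ * normSq y) x :=
      (by fun_prop : DifferentiableAt ℝ (fun y => 1 + κ * normSq y) x).continuousAt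
    filter_upwards [hc.eventually (lt_mem_nhds ha)] with y hy
    exact inwardNormal_gKappa hy
  have hd : DifferentiableAt ℝ (fun y : Plane => -(‖y‖ * (1 + κ * normSq y))⁻¹) x := by
    have h1 : DifferentiableAt ℝ (fun y : Plane => ‖y‖) x :=
      (contDiffAt_norm ℝ (n := 1) hx0).differentiableAt (by simp)
    have h2 : ‖x‖ * (1 + κ * normSq x) ≠ 0 := mul_ne_zero (by simpa using hx0) ha.ne'
    exact ((h1.mul (by fun_prop)).inv h2).neg
  have hf : fderiv ℝ (inwardNormal (gKappa κ)) x v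
      = (-(‖x‖ * (1 + κ * normSq x))⁻¹) • v
        + (fderiv ℝ (fun y : Plane => -(‖y‖ * (1 + κ * normSq y))⁻¹) x v) • x := by
    rw [Filter.EventuallyEq.fderiv_eq hev, fderiv_fun_smul hd differentiableAt_fun_id]
    simp
  have hv' : 0 < v 0 * v 0 + v 1 * v 1 := by
    have : 0 < ‖v‖ ^ 2 := by positivity
    rwa [← normSq_eq] at this
  rw [secondFundamentalForm, covDeriv, hf, connectionTerm_gKappa, pairing_gKappa, hxv']
  simp only [PiLp.add_apply, PiLp.smul_apply, smul_eq_mul, hxR]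
  generalize fderiv ℝ (fun y : Plane => -(‖y‖ * (1 + κ * normSq y))⁻¹) x v = d
  generalize (κ ^ 2 * _ + _) / (1 + κ * normSq x) ^ 2 = e
  have : 0 < (R * (1 + κ * normSq x))⁻¹ * (v 0 * v 0 + v 1 * v 1) := by positivity
  linear_combination this + (d + e) * hxv'

/-! ### First integrals of the geodesic flow. -/

theorem eq_left_of_hasDerivWithinAt_zero {f : ℝ → ℝ} {a b : ℝ}
    (h : ∀ t ∈ Set.Icc a b, HasDerivWithinAt f 0 (Set.Icc a b) t) :
    ∀ t ∈ Set.Icc a b, f t = f a := by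
  refine constant_of_derivWithin_zero (fun t ht => (h t ht).differentiableWithinAt)
    fun t ht => ?_
  have ht' := Set.Ico_subset_Icc_self ht
  exact (h t ht').derivWithin (uniqueDiffOn_Icc (ht.1.trans_lt ht.2) t ht')

/-- The rotational Jacobi field `(1 + κ |x|²) ⟨x, v⟩`. -/
def rotationField (κ : ℝ) (x v : Plane) : ℝ := (1 + κ * normSq x) * (x 0 * v 0 + x 1 * v 1)

/-- The angular momentum `x₀ v₁ - x₁ v₀`. -/
def angularMomentum (x v : Plane) : ℝ := x 0 * v 1 - x 1 * v 0

/-- Radial and angular parts of the speed: this is `|x|² g(v, v)` split orthogonally. -/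
theorem normSq_eq_of_unit {κ : ℝ} {x v : Plane} (h : pairing (gKappa κ) x v v = 1) :
    normSq x = rotationField κ x v ^ 2 + angularMomentum x v ^ 2 := by
  rw [pairing_gKappa] at h
  simp only [rotationField, angularMomentum, normSq] at *
  linear_combination (-(x 0 * x 0 + x 1 * x 1)) * h

namespace IsUnitGeodesicOn

variable {κ R : ℝ} {γ v : ℝ → Plane} {I : Set ℝ}

theorem hasDerivWithinAt_normSq (hγ : IsUnitGeodesicOn (gKappa κ) R γ v I) {t : ℝ} (ht : t ∈ I) :
    HasDerivWithinAt (fun t => normSq (γ t)) (2 * (γ t 0 * v t 0 + γ t 1 * v t 1)) I t := by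
  have h := hasDerivWithinAt_plane.1 (hγ.hasDeriv t ht)
  exact (((h 0).mul (h 0)).add ((h 1).mul (h 1))).congr_deriv (by ring)

theorem hasDerivWithinAt_rotationField (hγ : IsUnitGeodesicOn (gKappa κ) R γ v I) {t : ℝ}
    (ht : t ∈ I) (h0 : 1 + κ * normSq (γ t) ≠ 0) :
    HasDerivWithinAt (fun t => rotationField κ (γ t) (v t)) (1 + κ * normSq (γ t))⁻¹ I t := by
  have h := hasDerivWithinAt_plane.1 (hγ.hasDeriv t ht)
  have h' := hasDerivWithinAt_plane.1 (hγ.geodesic t ht)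
  refine ((((hγ.hasDerivWithinAt_normSq ht).const_mul κ).const_add 1).mul
    (((h 0).mul (h' 0)).add ((h 1).mul (h' 1)))).congr_deriv ?_
  have hu := hγ.unit t ht
  rw [pairing_gKappa] at hu
  rw [connectionTerm_gKappa]
  simp only [PiLp.neg_apply, PiLp.smul_apply, smul_eq_mul, Pi.add_apply, Pi.mul_apply]
  have e : normSq (γ t) = γ t 0 * γ t 0 + γ t 1 * γ t 1 := rfl
  generalize normSq (γ t) = s at *
  generalize γ t 0 = p at *
  generalize γ t 1 = q at *
  generalize v t 0 = a at *
  generalize v t 1 = b at *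
  field_simp
  subst e
  linear_combination hu

theorem hasDerivWithinAt_angularMomentum (hγ : IsUnitGeodesicOn (gKappa κ) R γ v I) {t : ℝ}
    (ht : t ∈ I) : HasDerivWithinAt (fun t => angularMomentum (γ t) (v t)) 0 I t := by
  have h := hasDerivWithinAt_plane.1 (hγ.hasDeriv t ht)
  have h' := hasDerivWithinAt_plane.1 (hγ.geodesic t ht)
  refine (((h 0).mul (h' 1)).sub ((h 1).mul (h' 0))).congr_deriv ?_
  rw [connectionTerm_gKappa]
  simp only [PiLp.neg_apply, PiLp.smul_apply, smul_eq_mul]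
  ring

theorem angularMomentum_eq {a b : ℝ} (hγ : IsUnitGeodesicOn (gKappa κ) R γ v (Set.Icc a b)) {t : ℝ}
    (ht : t ∈ Set.Icc a b) : angularMomentum (γ t) (v t) = angularMomentum (γ a) (v a) :=
  eq_left_of_hasDerivWithinAt_zero (fun _ hs => hγ.hasDerivWithinAt_angularMomentum hs) t ht

theorem normSq_eq {a b : ℝ} (hγ : IsUnitGeodesicOn (gKappa κ) R γ v (Set.Icc a b)) {t : ℝ}
    (ht : t ∈ Set.Icc a b) : normSq (γ t)
      = rotationField κ (γ t) (v t) ^ 2 + angularMomentum (γ a) (v a) ^ 2 := by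
  rw [normSq_eq_of_unit (hγ.unit t ht), hγ.angularMomentum_eq ht]

/-- The integrated form of `w' = 1 / (1 + κ (w² + L²))`. -/
theorem rotationField_cubic {a b : ℝ} (hR : 0 ≤ R) (h : |κ| * R ^ 2 < 1)
    (hγ : IsUnitGeodesicOn (gKappa κ) R γ v (Set.Icc a b)) {t : ℝ} (ht : t ∈ Set.Icc a b) :
    (rotationField κ (γ t) (v t) - rotationField κ (γ a) (v a)) *
      (1 + κ * ((rotationField κ (γ t) (v t) ^ 2
        + rotationField κ (γ t) (v t) * rotationField κ (γ a) (v a)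
        + rotationField κ (γ a) (v a) ^ 2) / 3 + angularMomentum (γ a) (v a) ^ 2)) = t - a := by
  have key := eq_left_of_hasDerivWithinAt_zero (a := a) (b := b)
    (f := fun t => rotationField κ (γ t) (v t) + κ * (rotationField κ (γ t) (v t) ^ 3 / 3
      + angularMomentum (γ a) (v a) ^ 2 * rotationField κ (γ t) (v t)) - t) (fun s hs => by
    have ha := (one_add_mul_normSq_pos hR h (hγ.mem s hs)).ne'
    have hw := hγ.hasDerivWithinAt_rotationField hs ha
    refine ((hw.add ((((hw.pow 3).div_const 3).add (hw.const_mul _)).const_mul κ)).sub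
      (hasDerivWithinAt_id s _)).congr_deriv ?_
    have e := hγ.normSq_eq hs
    generalize normSq (γ s) = n at *
    field_simp
    push_cast
    rw [e]
    ring) t ht
  linear_combination key

/-- Both `p² + L²` and `q² + L²` are at most `R²`, and `|pq| ≤ (p² + q²)/2`. The first bound serves
the conjugate point condition, the second the integrated equation. -/
theorem cubic_factor_bounds {a b : ℝ} (hR : 0 ≤ R)
    (hγ : IsUnitGeodesicOn (gKappa κ) R γ v (Set.Icc a b)) {s t : ℝ}
    (hs : s ∈ Set.Icc a b) (ht : t ∈ Set.Icc a b) :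
    |rotationField κ (γ t) (v t) * rotationField κ (γ s) (v s)
      + angularMomentum (γ a) (v a) ^ 2| ≤ R ^ 2 ∧
    |(rotationField κ (γ t) (v t) ^ 2
        + rotationField κ (γ t) (v t) * rotationField κ (γ s) (v s)
        + rotationField κ (γ s) (v s) ^ 2) / 3 + angularMomentum (γ a) (v a) ^ 2| ≤ R ^ 2 := by
  have h1 := (mem_disk_iff hR _).1 (hγ.mem s hs)
  have h2 := (mem_disk_iff hR _).1 (hγ.mem t ht)
  rw [hγ.normSq_eq hs] at h1
  rw [hγ.normSq_eq ht] at h2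
  generalize rotationField κ (γ t) (v t) = p at *
  generalize rotationField κ (γ s) (v s) = q at *
  generalize angularMomentum (γ a) (v a) = l at *
  have h3 := sq_nonneg (p - q)
  have h4 := sq_nonneg (p + q)
  have h5 := sq_nonneg l
  constructor <;> rw [abs_le] <;> constructor <;> nlinarith

theorem length_le {a b : ℝ} (hab : a ≤ b) (hR : 0 ≤ R) (h : |κ| * R ^ 2 < 1)
    (hγ : IsUnitGeodesicOn (gKappa κ) R γ v (Set.Icc a b)) : b - a ≤ 4 * R := by
  have ha := Set.left_mem_Icc.2 hab
  have hb := Set.right_mem_Icc.2 hab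
  have e := hγ.rotationField_cubic hR h hb
  obtain ⟨f1, f2⟩ := one_add_mul_bounds h (hγ.cubic_factor_bounds hR ha hb).2
  have h1 := (mem_disk_iff hR _).1 (hγ.mem a ha)
  have h2 := (mem_disk_iff hR _).1 (hγ.mem b hb)
  rw [hγ.normSq_eq ha] at h1
  rw [hγ.normSq_eq hb] at h2
  have h3 := (abs_le_of_sq_le_sq' (by nlinarith [sq_nonneg (angularMomentum (γ a) (v a))]) hR :
    -R ≤ rotationField κ (γ a) (v a) ∧ _)
  have h4 := (abs_le_of_sq_le_sq' (by nlinarith [sq_nonneg (angularMomentum (γ a) (v a))]) hR :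
    -R ≤ rotationField κ (γ b) (v b) ∧ _)
  -- The increment of `w` is at most `2R` and the cubic factor lies in `(0, 2)`, whence `4R`.
  rw [← e]
  generalize 1 + κ * _ = f at *
  nlinarith

theorem rotationField_lt {a b : ℝ} (hab : a < b) (hR : 0 ≤ R) (h : |κ| * R ^ 2 < 1)
    (hγ : IsUnitGeodesicOn (gKappa κ) R γ v (Set.Icc a b)) :
    rotationField κ (γ a) (v a) < rotationField κ (γ b) (v b) := by
  have ha := Set.left_mem_Icc.2 hab.le
  have hb := Set.right_mem_Icc.2 hab.le
  have e := hγ.rotationField_cubic hR h hb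
  obtain ⟨f1, f2⟩ := one_add_mul_bounds h (hγ.cubic_factor_bounds hR ha hb).2
  rw [← sub_pos]
  refine pos_of_mul_pos_left ?_ f1.le
  rw [e]
  linarith

end IsUnitGeodesicOn

/-! ### Non-trapping and absence of conjugate points. -/

theorem isNonTrapping_gKappa {R κ : ℝ} (hR : 0 < R) (h : |κ| * R ^ 2 < 1) :
    IsNonTrapping (gKappa κ) R := by
  refine lt_of_le_of_lt (b := ENNReal.ofReal (4 * R)) ?_ ENNReal.ofReal_lt_top
  refine iSup_le fun x => iSup_le fun v => iSup_le fun _ => iSup_le fun T => iSup_le ?_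
  rintro ⟨hT, γ, w, hγ, -, -⟩
  refine ENNReal.ofReal_le_ofReal ?_
  simpa using hγ.length_le hT hR.le h

/-- Abel's identity: the Wronskian of two solutions of `j'' + K j = 0` is constant. -/
theorem wronskian_eq {K j j' y y' : ℝ → ℝ} {a b : ℝ}
    (hj : ∀ t ∈ Set.Icc a b, HasDerivWithinAt j (j' t) (Set.Icc a b) t)
    (hj' : ∀ t ∈ Set.Icc a b, HasDerivWithinAt j' (-(K t * j t)) (Set.Icc a b) t)
    (hy : ∀ t ∈ Set.Icc a b, HasDerivWithinAt y (y' t) (Set.Icc a b) t)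
    (hy' : ∀ t ∈ Set.Icc a b, HasDerivWithinAt y' (-(K t * y t)) (Set.Icc a b) t)
    {t : ℝ} (ht : t ∈ Set.Icc a b) :
    j t * y' t - j' t * y t = j a * y' a - j' a * y a :=
  eq_left_of_hasDerivWithinAt_zero (f := fun t => j t * y' t - j' t * y t)
    (fun s hs => (((hj s hs).mul (hy' s hs)).sub ((hj' s hs).mul (hy s hs))).congr_deriv
      (by ring)) t ht

theorem not_hasConjugatePoints_gKappa {R κ : ℝ} (hR : 0 < R) (h : |κ| * R ^ 2 < 1) :
    ¬ HasConjugatePoints (gKappa κ) R := by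
  rintro ⟨γ, v, a, b, hab, hγ, j, j', hj, hj', ja, jb, t, ht, hjt⟩
  have hA := Set.left_mem_Icc.2 hab.le
  have hB := Set.right_mem_Icc.2 hab.le
  have hlt := hγ.rotationField_lt hab hR.le h
  have hpos := (one_add_mul_bounds h (hγ.cubic_factor_bounds hR.le hA hB).1).1
  have hpos' := (one_add_mul_bounds h (hγ.cubic_factor_bounds hR.le hA hA).1).1
  have hn := fun s hs => hγ.normSq_eq (t := s) hs
  have ha := fun s hs => (one_add_mul_normSq_pos hR.le h (hγ.mem s hs)).ne'
  have hw := fun s hs => hγ.hasDerivWithinAt_rotationField (t := s) hs (ha s hs)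
  have hK := fun s hs => gaussCurvature_gKappa (ha s hs)
  have hs' := fun s hs => hγ.hasDerivWithinAt_normSq (t := s) hs
  have hu : ∀ s, rotationField κ (γ s) (v s)
    = (1 + κ * normSq (γ s)) * (γ s 0 * v s 0 + γ s 1 * v s 1) := fun _ => rfl
  set w : ℝ → ℝ := fun s => rotationField κ (γ s) (v s) with hwdef
  set l := angularMomentum (γ a) (v a)
  set n : ℝ → ℝ := fun s => normSq (γ s)
  -- As `w' = (1 + κn)⁻¹`, this is the Jacobi equation for `w`.
  have hinv : ∀ s ∈ Set.Icc a b, HasDerivWithinAt (fun s => (1 + κ * n s)⁻¹)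
      (-(gaussCurvature (gKappa κ) (γ s) * w s)) (Set.Icc a b) s := fun s hs => by
    refine ((((hs' s hs).const_mul κ).const_add 1).fun_inv (ha s hs)).congr_deriv ?_
    rw [hK s hs]
    simp only [hwdef, hu]
    have := ha s hs
    change 1 + κ * n s ≠ 0 at this
    simp only [show normSq (γ s) = n s from rfl]
    field_simp
  -- Second solution by reduction of order: `w ∫ dt/w²` with `dt = (1 + κ(w² + l²)) dw`.
  have hy : ∀ s ∈ Set.Icc a b, HasDerivWithinAt (fun s => κ * w s ^ 2 - (1 + κ * l ^ 2))
      (2 * κ * w s * (1 + κ * n s)⁻¹) (Set.Icc a b) s := fun s hs =>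
    ((((hw s hs).pow 2).const_mul κ).sub_const _).congr_deriv (by simp; ring)
  have hy' : ∀ s ∈ Set.Icc a b, HasDerivWithinAt (fun s => 2 * κ * w s * (1 + κ * n s)⁻¹)
      (-(gaussCurvature (gKappa κ) (γ s) * (κ * w s ^ 2 - (1 + κ * l ^ 2)))) (Set.Icc a b) s :=
    fun s hs => by
    refine (((hw s hs).const_mul (2 * κ)).mul (hinv s hs)).congr_deriv ?_
    rw [hK s hs]
    have h1 := ha s hs
    have h2 : n s = w s ^ 2 + l ^ 2 := hn s hs
    change 1 + κ * n s ≠ 0 at h1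
    simp only [show normSq (γ s) = n s from rfl]
    generalize n s = m at *
    generalize w s = z at *
    field_simp
    rw [h2]
    ring
  have W1 := fun s hs => wronskian_eq hj hj' hw hinv (t := s) hs
  have W2 := fun s hs => wronskian_eq hj hj' hy hy' (t := s) hs
  have E1 := W1 b hB
  have E2 := W2 b hB
  have F1 := W1 t ht
  have F2 := W2 t ht
  simp only [ja, jb, zero_mul, zero_sub] at E1 E2 F1 F2
  -- Otherwise `j` has zero Wronskian with both `w` and `y`; these have Wronskian 1, so `j` would
  -- vanish at `t`.
  have hp : j' a ≠ 0 := by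
    intro h0
    rw [h0, zero_mul, neg_zero] at F1 F2
    apply hjt
    have h1 := ha t ht
    have h2 : n t = w t ^ 2 + l ^ 2 := hn t ht
    change 1 + κ * n t ≠ 0 at h1
    change j t * (1 + κ * n t)⁻¹ - j' t * w t = 0 at F1
    have h3 := mul_inv_cancel₀ h1
    generalize (1 + κ * n t)⁻¹ = i at *
    rw [h2] at h3
    linear_combination w t * F2 - (κ * w t ^ 2 - (1 + κ * l ^ 2)) * F1 - j t * h3
  have hab0 : j' a * j' b * ((w b - w a) * (1 + κ * (w b * w a + l ^ 2))) = 0 := by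
    linear_combination j' a * (κ * w a ^ 2 - (1 + κ * l ^ 2)) * E1 - j' a * w a * E2
  -- Otherwise `w` and `y` would both vanish at `a`, although `w a = 0` gives `y a = -(1 + κl²) <
  -- 0`.
  have hq : j' b ≠ 0 := by
    intro h0
    rw [h0, zero_mul, neg_zero, zero_eq_neg] at E1 E2
    have hwa := (mul_eq_zero.1 E1).resolve_left hp
    have hya := (mul_eq_zero.1 E2).resolve_left hp
    change 0 < 1 + κ * (w a * w a + l ^ 2) at hpos'
    rw [hwa] at hya hpos'
    linarith
  exact mul_ne_zero (mul_ne_zero hp hq) (mul_ne_zero (sub_pos.2 hlt).ne' hpos.ne') hab0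

theorem isSimpleSurface_gKappa {R κ : ℝ} (hR : 0 < R) (h : |κ| * R ^ 2 < 1) :
    IsSimpleSurface (gKappa κ) R where
  isRiemannianMetric := gKappa_isRiemannianMetric (by
    have := (abs_lt.1 (by rwa [abs_mul, abs_of_nonneg (sq_nonneg R)] : |κ * R ^ 2| < 1)).1
    exact this)
  isStrictlyConvex := isStrictlyConvex_gKappa hR h
  isNonTrapping := isNonTrapping_gKappa hR h
  noConjugatePoints := not_hasConjugatePoints_gKappa hR h

/-! ### Conjugate points on a diameter. -/

/-- The inverse of the radial distance function `x ↦ x + κ x³ / 3`. -/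
theorem exists_radial_inverse {κ : ℝ} (hκ : 0 < κ) :
    ∃ x : ℝ → ℝ, (∀ y, x (y + κ * y ^ 3 / 3) = y) ∧ StrictMono x ∧
      ∀ t, HasDerivAt x (1 + κ * x t ^ 2)⁻¹ t := by
  have hd : ∀ y, HasDerivAt (fun y : ℝ => y + κ * y ^ 3 / 3) (1 + κ * y ^ 2) y := fun y =>
    ((hasDerivAt_id y).add ((((hasDerivAt_id y).pow 3).const_mul κ).div_const 3)).congr_deriv
      (by simp; ring)
  have hc : Continuous (fun y : ℝ => y + κ * y ^ 3 / 3) := by fun_prop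
  have hm : StrictMono (fun y : ℝ => y + κ * y ^ 3 / 3) :=
    strictMono_of_deriv_pos fun y => by
      rw [(hd y).deriv]
      positivity
  have hs : Function.Surjective (fun y : ℝ => y + κ * y ^ 3 / 3) := by
    refine hc.surjective ?_ ?_
    · refine Filter.tendsto_atTop_mono' _ ?_ Filter.tendsto_id
      filter_upwards [Filter.eventually_ge_atTop 0] with y hy
      have : 0 ≤ κ * y ^ 3 / 3 := by positivity
      simpa using this
    · refine Filter.tendsto_atBot_mono' _ ?_ Filter.tendsto_id
      filter_upwards [Filter.eventually_le_atBot 0] with y hy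
      have : 0 ≤ κ * (-y) ^ 3 / 3 := by
        have : 0 ≤ -y := by linarith
        positivity
      have e : κ * (-y) ^ 3 / 3 = -(κ * y ^ 3 / 3) := by ring
      simp only [id]
      linarith
  let e := hm.orderIsoOfSurjective _ hs
  refine ⟨e.symm, fun y => e.symm_apply_apply y, e.symm.strictMono, fun t => ?_⟩
  have h0 : (1 + κ * e.symm t ^ 2) ≠ 0 := by positivity
  exact HasDerivAt.of_local_left_inverse e.symm.continuous.continuousAt (hd _) h0
    (Filter.Eventually.of_forall fun y => e.apply_symm_apply y)

theorem hasConjugatePoints_gKappa {R κ : ℝ} (hR : 0 < R) (h : 1 / R ^ 2 ≤ κ) :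
    HasConjugatePoints (gKappa κ) R := by
  have hκ : 0 < κ := lt_of_lt_of_le (by positivity) h
  have hκR : 1 ≤ κ * R ^ 2 := by rwa [div_le_iff₀ (by positivity)] at h
  obtain ⟨x, hx, hm, hd⟩ := exists_radial_inverse hκ
  -- The positive zero of `1 - κx²`; `κR² ≥ 1` gives `c ≤ R`.
  set c := (Real.sqrt κ)⁻¹ with hc
  have hc0 : 0 < c := by positivity
  have hc2 : κ * c ^ 2 = 1 := by
    rw [hc, inv_pow, Real.sq_sqrt hκ.le]
    field_simp
  have hpos : ∀ t, 0 < 1 + κ * x t ^ 2 := fun t => by positivity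
  have hn : ∀ p : ℝ, normSq !₂[p, 0] = p ^ 2 := fun p => by simp [normSq]; ring
  have hv : ∀ t, HasDerivAt (fun t => (1 + κ * x t ^ 2)⁻¹)
      (-(2 * κ * x t) / (1 + κ * x t ^ 2) ^ 3) t := fun t => by
    refine (((((hd t).pow 2).const_mul κ).const_add 1).fun_inv (hpos t).ne').congr_deriv ?_
    have := (hpos t).ne'
    simp
    field_simp
  have hj : ∀ t, HasDerivAt (fun t => 1 - κ * x t ^ 2)
      (-(2 * κ * (x t * (1 + κ * x t ^ 2)⁻¹))) t := fun t =>
    ((((hd t).pow 2).const_mul κ).const_sub 1).congr_deriv (by simp; ring)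
  have xT := hx c
  have xT' := hx (-c)
  -- The diameter parametrized by arc length from the centre, between the times at which `x = -c`
  -- and `x = c`; the Jacobi field equals 1 at time 0.
  refine ⟨fun t => !₂[x t, 0], fun t => !₂[(1 + κ * x t ^ 2)⁻¹, 0], -c + κ * (-c) ^ 3 / 3,
    c + κ * c ^ 3 / 3, ?_, ⟨?_, ?_, ?_, ?_⟩, fun t => 1 - κ * x t ^ 2,
    fun t => -(2 * κ * (x t * (1 + κ * x t ^ 2)⁻¹)), ?_, ?_, ?_, ?_, 0, ?_, ?_⟩
  · rw [← hm.lt_iff_lt, xT, xT']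
    linarith
  · intro t ht
    have h1 := hm.monotone ht.1
    have h2 := hm.monotone ht.2
    rw [xT'] at h1
    rw [xT] at h2
    rw [mem_disk_iff hR.le, hn]
    have : x t ^ 2 ≤ c ^ 2 := sq_le_sq' h1 h2
    nlinarith
  · intro t _
    rw [pairing_gKappa, hn]
    have := (hpos t).ne'
    simp
    field_simp
    ring
  · intro t _
    rw [hasDerivWithinAt_plane]
    intro i
    fin_cases i
    · simpa using (hd t).hasDerivWithinAt
    · simpa using hasDerivWithinAt_const t _ (0 : ℝ)
  · intro t _
    rw [hasDerivWithinAt_plane, connectionTerm_gKappa, hn]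
    intro i
    fin_cases i
    · refine ((hv t).hasDerivWithinAt (s := _)).congr_deriv ?_
      have := (hpos t).ne'
      simp
      field_simp
      ring
    · simpa using hasDerivWithinAt_const t _ (0 : ℝ)
  · exact fun t _ => (hj t).hasDerivWithinAt
  · intro t _
    refine ((((hd t).mul (hv t)).const_mul (2 * κ)).neg.hasDerivWithinAt).congr_deriv ?_
    have := (hpos t).ne'
    rw [gaussCurvature_gKappa (by rwa [hn]), hn]
    field_simp
    ring
  · simp only [xT']
    linarith
  · simp only [xT]
    linarith
  · constructor
    · have : 0 ≤ κ * c ^ 3 / 3 := by positivity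
      linarith [show κ * (-c) ^ 3 / 3 = -(κ * c ^ 3 / 3) by ring]
    · positivity
  · have : x 0 = 0 := by simpa using hx 0
    simp [this]

end HerglotzDisk

theorem corollary4 (R : ℝ) (hR : 0 < R) (κ : ℝ) :
    (|κ| * R ^ 2 < 1 → HerglotzDisk.IsSimpleSurface (HerglotzDisk.gKappa κ) R) ∧
    (1 / R ^ 2 ≤ κ → HerglotzDisk.HasConjugatePoints (HerglotzDisk.gKappa κ) R) :=
  ⟨HerglotzDisk.isSimpleSurface_gKappa hR, HerglotzDisk.hasConjugatePoints_gKappa hR⟩
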